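/- **Setting.** An mDAG $\mathcal G$ consists of finite disjoint sets $V$ (random vertices) and $W$ (fixed vertices), an acyclic set of directed edges on $V\cup W$ with no edge pointing into $W$, and a collection $\mathcal B$ of pairwise inclusion-incomparable subsets of $V$ of size at least two (the bidirected edges). Write $\mathrm{pa}(v)$ for the parents of $v$ and $\mathrm{pa}(C)=\bigcup_{v\in C}\mathrm{pa}(v)$. A set $C\subseteq V$ is bidirected-connected if any two of its elements are joined by a path in $C$ whose consecutive members lie in a common bidirected edge; a district is an inclusion-maximal nonempty bidirected-connected set. For $D\subseteq V$, $\mathcal G[D]$ has random vertices $D$, fixed vertices $\mathrm{pa}(D)\setminus D$, the directed edges pointing into $D$, and as bidirected edges the inclusion-maximal sets among the $B\cap D$, $B\in\mathcal B$, of size at least two. A set $S$ is intrinsic if it is a district of some graph obtained from $\mathcal G$ by finitely many (possibly zero) steps, each passing from the current graph to its subgraph on one of its districts or deleting one of its childless random vertices. The parametrizable sets are $$\mathcal A(\mathcal G)=\{(S\setminus \mathrm{pa}(S))\cup A' : S \text{ intrinsic},\ A'\subseteq \mathrm{pa}(S)\}.$$ Each $v\in V\cup W$ has a finite state space $\mathfrak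 X_v$, with $|\mathfrak X_v|\ge 2$ for $v\in V$; put $\mathfrak X_D=\prod_{v\in D}\mathfrak X_v$ and $\mathfrak X_{VW}=\mathfrak X_{V\cup W}$. For $A\subseteq V\cup W$, $\Lambda_A$ is the space of functions $\mathfrak X_{VW}\to\mathbb R$ that depend only on $x_A$ and whose sum over $x_a$, the other coordinates being fixed, is $0$ for each $a\in A$. A gearing of $\mathcal G$ is an ordering $B_1,\dots,B_k$ of $\mathcal B$ such that for each $j>1$ there is $s<j$ with $B_j\cap\bigcup_{i<j}B_i=B_j\cap B_s$; $\mathcal G$ is geared if it has one. Its remainder sets are $R_j=B_j\setminus\bigcup_{i<j}B_i$. For $v\in R_j$ let $\pi(v)$ be the union of all $R_i$ with $i>j$ and $v\in B_i$, and define recursively $\mathcal F_v=\{f:\mathfrak X_{\mathrm{pa}(v)}\times\prod_{w\in\pi(v)}\mathcal F_w\to\mathfrak X_v\}$; put $\mathcal F_{R_i}=\prod_{v\in R_i}\mathcal F_v$. For weights $\rho_i:\mathcal F_{R_i}\to\mathbb R$, define $\mathbf P[\rho_k,\dots,\rho_1]\in\mathbb R^{\mathfrak X_{VW}}$ by $$\mathbf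 P[\rho_k,\dots,\rho_1](x)=\sum_{f}\prod_{i=1}^k\rho_i(f_{R_i}),$$ the sum being over all $f\in\prod_{v\in V}\mathcal F_v$ with $f_v(x_{\mathrm{pa}(v)},f_{\pi(v)})=x_v$ for every $v\in V$. Let $T_i$ be the vector space of all limits $$D_i(\varepsilon)=\lim_{\eta\downarrow0}\eta^{-1}\bigl(\mathbf P[1,\dots,1+\eta\varepsilon,\dots,1]-\mathbf P[1,\dots,1]\bigr)$$ with $1+\eta\varepsilon$ in the place of $\rho_i$, where $\varepsilon:\mathcal F_{R_i}\to\mathbb R$ satisfies $\sum_{g\in\mathcal F_{R_i}}\varepsilon(g)=0$. (The constant weight $1$ is the uniform distribution up to normalization, which does not affect $T_i$.) **Corollary 5.6.** Let $\mathcal G$ be a geared mDAG in which every random vertex lies in a bidirected edge (for instance, a geared mDAG with a single district and at least one bidirected edge). Then for every gearing $B_1,\dots,B_k$ of $\mathcal G$, the sum of the spaces $\Lambda_A$, $A\in\mathcal A(\mathcal G)$, is direct and $$\bigoplus_{A\in\mathcal A(\mathcal G)}\Lambda_A\ \le\ T_1+\cdots+T_k .$$ -/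

import Mathlib

open Filter Topology

universe u w

/-- A hypergraph with random vertices `V`, fixed vertices `W`, directed edges `E` (the pair `(a, b)`
stands for `a → b`) and bidirected hyperedges `B`. The directed part is acyclic (in particular
without loops), fixed vertices have no parents, and the bidirected edges are pairwise incomparable
sets of at least two random vertices. -/
structure MDAG (ι : Type u) [DecidableEq ι] where
  V : Finset ι
  W : Finset ι
  disj : Disjoint V W
  E : Finset (ι × ι)
  edge_mem : ∀ a b, (a, b) ∈ E → a ∈ V ∪ W ∧ b ∈ V
  acyclic : ∀ a, ¬ Relation.TransGen (fun a b => (a, b) ∈ E) a a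
  B : Finset (Finset ι)
  bi_subset : ∀ e ∈ B, e ⊆ V
  bi_card : ∀ e ∈ B, 2 ≤ e.card
  bi_antichain : IsAntichain (· ⊆ ·) (B : Set (Finset ι))

namespace MDAG

variable {ι : Type u} [DecidableEq ι]

/-- All vertices, random and fixed. -/
def verts (G : MDAG ι) : Finset ι := G.V ∪ G.W

/-- The parents of a vertex. -/
def pa (G : MDAG ι) (v : ι) : Finset ι := G.verts.filter fun a => (a, v) ∈ G.E

/-- The parents of a set of vertices: the union of the parent sets of its elements. -/
def paSet (G : MDAG ι) (C : Finset ι) : Finset ι := C.biUnion G.pa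

/-- The elements of `C` that have no child in `C`. -/
def sterile (G : MDAG ι) (C : Finset ι) : Finset ι := C \ G.paSet C

theorem pa_subset (G : MDAG ι) (v : ι) : G.pa v ⊆ G.verts := Finset.filter_subset _ _

/-- A set `C` of random vertices is bidirected-connected if any two of its elements are joined by a
path in `C` whose consecutive members lie in a common bidirected edge. -/
def IsBiConnected (G : MDAG ι) (C : Finset ι) : Prop :=
  C ⊆ G.V ∧ ∀ a ∈ C, ∀ b ∈ C,
    Relation.ReflTransGen (fun c d => c ∈ C ∧ d ∈ C ∧ ∃ e ∈ G.B, c ∈ e ∧ d ∈ e) a b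

/-- A district: an inclusion-maximal (nonempty) bidirected-connected set. The districts partition
the random vertices. -/
def IsDistrict (G : MDAG ι) (D : Finset ι) : Prop :=
  D.Nonempty ∧ Maximal G.IsBiConnected D

/-- The inclusion-maximal sets among those sets `e ∩ D`, `e` a bidirected edge, that have at least
two elements. -/
def traceEdges (G : MDAG ι) (D : Finset ι) : Finset (Finset ι) :=
  let S := (G.B.image fun e => e ∩ D).filter fun e => 2 ≤ e.card
  S.filter fun e => ∀ e' ∈ S, e ⊆ e' → e = e'

theorem traceEdges_subset (G : MDAG ι) (D : Finset ι) : ∀ e ∈ G.traceEdges D, e ⊆ D := by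
  intro e he
  simp only [traceEdges, Finset.mem_filter, Finset.mem_image] at he
  obtain ⟨⟨⟨e', -, rfl⟩, -⟩, -⟩ := he
  exact Finset.inter_subset_right

theorem traceEdges_card (G : MDAG ι) (D : Finset ι) : ∀ e ∈ G.traceEdges D, 2 ≤ e.card := by
  intro e he
  simp only [traceEdges, Finset.mem_filter] at he
  exact he.1.2

theorem traceEdges_antichain (G : MDAG ι) (D : Finset ι) :
    IsAntichain (· ⊆ ·) (G.traceEdges D : Set (Finset ι)) := by
  intro e he e' he' hne hsub
  have h1 := (Finset.mem_filter.1 (Finset.mem_coe.1 he)).2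
  have h2 := (Finset.mem_filter.1 (Finset.mem_coe.1 he')).1
  exact hne (h1 e' h2 hsub)

/-- The subgraph `G[D]`: random vertices `D`, fixed vertices `pa(D) \ D`, all directed edges of `G`
that point into `D`, and the traces on `D` of the bidirected edges. -/
def sub (G : MDAG ι) (D : Finset ι) (_hD : D ⊆ G.V) : MDAG ι where
  V := D
  W := G.paSet D \ D
  disj := Finset.disjoint_sdiff
  E := G.E.filter fun p => p.2 ∈ D
  edge_mem a b h := by
    rw [Finset.mem_filter] at h
    refine ⟨?_, h.2⟩
    rw [Finset.union_sdiff_self_eq_union]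
    refine Finset.mem_union_right _ (Finset.mem_biUnion.2 ⟨b, h.2, ?_⟩)
    exact Finset.mem_filter.2 ⟨(G.edge_mem a b h.1).1, h.1⟩
  acyclic a h := G.acyclic a (Relation.TransGen.mono (fun _ _ hab => (Finset.mem_filter.1 hab).1) _ _ h)
  B := G.traceEdges D
  bi_subset := G.traceEdges_subset D
  bi_card := G.traceEdges_card D
  bi_antichain := G.traceEdges_antichain D

/-- The induced subgraph obtained by removing the random vertex `v`. -/
def remove (G : MDAG ι) (v : ι) (_hv : v ∈ G.V) : MDAG ι where
  V := G.V.erase v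
  W := G.W
  disj := G.disj.mono_left (Finset.erase_subset _ _)
  E := G.E.filter fun p => p.1 ≠ v ∧ p.2 ≠ v
  edge_mem a b h := by
    rw [Finset.mem_filter] at h
    have h1 := G.edge_mem a b h.1
    refine ⟨?_, Finset.mem_erase.2 ⟨h.2.2, h1.2⟩⟩
    rcases Finset.mem_union.1 h1.1 with h2 | h2
    · exact Finset.mem_union_left _ (Finset.mem_erase.2 ⟨h.2.1, h2⟩)
    · exact Finset.mem_union_right _ h2
  acyclic a h := G.acyclic a (Relation.TransGen.mono (fun _ _ hab => (Finset.mem_filter.1 hab).1) _ _ h)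
  B := G.traceEdges (G.V.erase v)
  bi_subset := G.traceEdges_subset _
  bi_card := G.traceEdges_card _
  bi_antichain := G.traceEdges_antichain _

/-- `G.Reaches H`: `H` arises from `G` by finitely many (possibly zero) steps, each of which either
passes from the current graph to its subgraph on one of its districts, or removes one of its random
vertices that has no children in it. -/
inductive Reaches (G : MDAG ι) : MDAG ι → Prop
  | refl : Reaches G G
  | district {H : MDAG ι} {D : Finset ι} (h : Reaches G H) (hD : H.IsDistrict D) :
      Reaches G (H.sub D hD.2.prop.1)
  | remove {H : MDAG ι} {v : ι} (h : Reaches G H) (hv : v ∈ H.V) (hch : ∀ b, (v, b) ∉ H.E) :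
      Reaches G (H.remove v hv)

/-- An intrinsic set is a district of some graph that `G` reaches. -/
def IsIntrinsic (G : MDAG ι) (S : Finset ι) : Prop :=
  ∃ H : MDAG ι, G.Reaches H ∧ H.IsDistrict S

/-- The parametrizable sets `𝒜(G)`: the sets `H ∪ A`, where `H = sterile(S)` is the recursive head
and `A` is a subset of the tail `pa(S)` of an intrinsic set `S`. -/
def parametrizableSets (G : MDAG ι) : Set (Finset ι) :=
  {A | ∃ S, G.IsIntrinsic S ∧ ∃ A' ⊆ G.paSet S, A = G.sterile S ∪ A'}

/-- The joint state space `𝔛_D` of the vertices in `D`. -/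
abbrev State (X : ι → Type w) (D : Finset ι) : Type (max u w) := ∀ v : D, X v

/-- The space `Λ_A` of real functions on `𝔛_D` that depend only on the coordinates in `A` and whose
sum over each single coordinate in `A` vanishes (used for `A ⊆ D`). -/
def Lam (X : ι → Type w) [∀ v, Fintype (X v)] (D A : Finset ι) :
    Submodule ℝ (State X D → ℝ) where
  carrier := {p | (∀ a : D, (a : ι) ∈ A → ∀ x : State X D,
        ∑ y : X a, p (Function.update x a y) = 0) ∧
      ∀ x y : State X D, (∀ a : D, (a : ι) ∈ A → x a = y a) → p x = p y}
  zero_mem' := by simp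
  add_mem' := by
    rintro p q ⟨hp1, hp2⟩ ⟨hq1, hq2⟩
    refine ⟨fun a ha x => ?_, fun x y h => ?_⟩
    · simp [Finset.sum_add_distrib, hp1 a ha x, hq1 a ha x]
    · simp [hp2 x y h, hq2 x y h]
  smul_mem' := by
    rintro c p ⟨hp1, hp2⟩
    refine ⟨fun a ha x => ?_, fun x y h => ?_⟩
    · simp [← Finset.mul_sum, hp1 a ha x]
    · simp [hp2 x y h]

/-- A gearing: an ordering `B 0, …, B (k - 1)` of the bidirected edges, without repetition, that
satisfies the running intersection property. -/
structure Gearing (G : MDAG ι) (k : ℕ) where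
  B : Fin k → Finset ι
  inj : Function.Injective B
  mem_iff : ∀ e, e ∈ G.B ↔ ∃ i, B i = e
  running : ∀ j : Fin k, 0 < (j : ℕ) → ∃ s < j,
    B j ∩ (Finset.univ.filter (· < j)).biUnion B = B j ∩ B s

namespace Gearing

variable {G : MDAG ι} {k : ℕ} (γ : G.Gearing k)

/-- The remainder sets `R j = B j \ ⋃ i < j, B i`. -/
def R (j : Fin k) : Finset ι := γ.B j \ (Finset.univ.filter (· < j)).biUnion γ.B

/-- `r v` is the unique `j` with `v ∈ R j` (and `0` if `v` lies in no bidirected edge). -/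
noncomputable def r (v : ι) : ℕ := sInf {n | ∃ j : Fin k, (j : ℕ) = n ∧ v ∈ γ.R j}

/-- `π(v)`: the union of the remainder sets `R i` over all `i > r v` with `v ∈ B i`. -/
noncomputable def π (v : ι) : Finset ι :=
  (Finset.univ.filter fun i : Fin k => γ.r v < i ∧ v ∈ γ.B i).biUnion γ.R

theorem R_subset (j : Fin k) : γ.R j ⊆ G.V :=
  Finset.sdiff_subset.trans (G.bi_subset _ ((γ.mem_iff _).2 ⟨j, rfl⟩))

theorem π_subset (v : ι) : γ.π v ⊆ G.V :=
  Finset.biUnion_subset.2 fun i _ => γ.R_subset i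

theorem R_unique {v : ι} {i j : Fin k} (hi : v ∈ γ.R i) (hj : v ∈ γ.R j) : i = j := by
  by_contra hne
  wlog h : i < j generalizing i j
  · exact this hj hi (Ne.symm hne) (lt_of_le_of_ne (not_lt.1 h) (Ne.symm hne))
  refine (Finset.mem_sdiff.1 hj).2 (Finset.mem_biUnion.2 ⟨i, by simpa using h, ?_⟩)
  exact (Finset.mem_sdiff.1 hi).1

theorem r_eq {v : ι} {j : Fin k} (hj : v ∈ γ.R j) : γ.r v = j := by
  have h : {n | ∃ j : Fin k, (j : ℕ) = n ∧ v ∈ γ.R j} = {(j : ℕ)} := by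
    ext n
    constructor
    · rintro ⟨i, rfl, hi⟩
      rw [γ.R_unique hi hj]
      rfl
    · rintro rfl
      exact ⟨j, rfl, hj⟩
  rw [r, h, csInf_singleton]

theorem sub_r_lt {v a : ι} (ha : a ∈ γ.π v) : k - γ.r a < k - γ.r v := by
  obtain ⟨i, hi, hai⟩ := Finset.mem_biUnion.1 ha
  have h1 := (Finset.mem_filter.1 hi).2.1
  have h2 := γ.r_eq hai
  have h3 := i.2
  omega

variable (X : ι → Type w)

/-- The set `ℱ_v` of all functions `𝔛_{pa(v)} × ℱ_{π(v)} → 𝔛_v`, by recursion along the gearing. -/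
def Fn (v : ι) : Type (max u w) :=
  State X (G.pa v) → (∀ a : γ.π v, Fn a) → X v
termination_by k - γ.r v
decreasing_by exact γ.sub_r_lt a.2

theorem Fn_def (v : ι) :
    γ.Fn X v = (State X (G.pa v) → (∀ a : γ.π v, γ.Fn X a) → X v) := by
  rw [Fn]

/-- The defining identification of the elements of `ℱ_v` with actual functions. -/
def fnEquiv (v : ι) : γ.Fn X v ≃ (State X (G.pa v) → (∀ a : γ.π v, γ.Fn X a) → X v) :=
  Equiv.cast (γ.Fn_def X v)

theorem Fn_finite [∀ v, Finite (X v)] (v : ι) : Finite (γ.Fn X v) := by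
  have : ∀ a : γ.π v, Finite (γ.Fn X a) := fun a => Fn_finite a
  exact Finite.of_equiv _ (γ.fnEquiv X v).symm
termination_by k - γ.r v
decreasing_by exact γ.sub_r_lt a.2

noncomputable instance fnFintype [∀ v, Fintype (X v)] (v : ι) : Fintype (γ.Fn X v) :=
  haveI := γ.Fn_finite X v
  Fintype.ofFinite _

/-- A value of the `i`-th latent variable `U_i = (f_v | v ∈ R i)`, i.e. an element of `ℱ_{R i}`. -/
abbrev Latent (i : Fin k) : Type (max u w) := ∀ v : γ.R i, γ.Fn X v

/-- The functions `f` evaluate to `x`: `x_v = f_v(x_{pa(v)}, f_{π(v)})` for every random `v`. -/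
def Evaluates (f : ∀ v : G.V, γ.Fn X v) (x : State X G.verts) : Prop :=
  ∀ v : G.V, γ.fnEquiv X v (f v) (Finset.restrict₂ (G.pa_subset v) x)
    (Finset.restrict₂ (π := γ.Fn X) (γ.π_subset v) f) = x ⟨v, Finset.mem_union_left _ v.2⟩

variable [∀ v, Fintype (X v)]

open Classical in
/-- The functional latent variable parametrization `P[ρ]`, a vector indexed by `𝔛_{VW}`: the entry
at `x` is the total weight `∏ i, ρ_i(f_{R i})` of the families `f` that, given `x_W`, jointly
evaluate to `x_V`. If the `ρ_i` are probability distributions, it is the conditional distribution of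
`X_V` given `X_W` when the latent variables are drawn independently from them. -/
noncomputable def P (ρ : ∀ i, γ.Latent X i → ℝ) : State X G.verts → ℝ := fun x =>
  ∑ f : (∀ v : G.V, γ.Fn X v) with γ.Evaluates X f x,
    ∏ i, ρ i (Finset.restrict₂ (π := γ.Fn X) (γ.R_subset i) f)

/-- The weights `(1, …, 1 + η ε, …, 1)`, with the perturbation in position `i`. -/
noncomputable def perturb (i : Fin k) (ε : γ.Latent X i → ℝ) (η : ℝ) :
    ∀ j, γ.Latent X j → ℝ :=
  Function.update (fun _ _ => 1) i fun g => 1 + η * ε g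

/-- The difference quotient `η⁻¹ (P[1, …, 1 + η ε, …, 1] - P[1, …, 1])`. -/
noncomputable def diffQuot (i : Fin k) (ε : γ.Latent X i → ℝ) (η : ℝ) : State X G.verts → ℝ :=
  η⁻¹ • (γ.P X (γ.perturb X i ε η) - γ.P X (fun _ _ => 1))

open Classical in
theorem diffQuot_eq (i : Fin k) (ε : γ.Latent X i → ℝ) {η : ℝ} (hη : η ≠ 0) :
    γ.diffQuot X i ε η = fun x => ∑ f : (∀ v : G.V, γ.Fn X v) with γ.Evaluates X f x,
      ε (Finset.restrict₂ (π := γ.Fn X) (γ.R_subset i) f) := by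
  have h : ∀ f : (∀ v : G.V, γ.Fn X v), ∏ j, γ.perturb X i ε η j
      (Finset.restrict₂ (π := γ.Fn X) (γ.R_subset j) f) =
      1 + η * ε (Finset.restrict₂ (π := γ.Fn X) (γ.R_subset i) f) := by
    intro f
    rw [Finset.prod_eq_single i]
    · simp [perturb]
    · intro j _ hj
      simp [perturb, Function.update_of_ne hj]
    · simp
  funext x
  simp only [diffQuot, P, Pi.smul_apply, Pi.sub_apply, smul_eq_mul, h, Finset.prod_const_one,
    Finset.sum_add_distrib, add_sub_cancel_left, ← Finset.mul_sum]
  rw [inv_mul_cancel_left₀ hη]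

/-- The space `T_i` of all derivatives `D_i(ε) = lim_{η ↓ 0} η⁻¹ (P[1, …, 1 + η ε, …, 1] - P[1, …, 1])`,
where `ε` is degenerate as a function of the latent variable `U_i`, i.e. sums to zero. -/
noncomputable def T (i : Fin k) : Submodule ℝ (State X G.verts → ℝ) where
  carrier := {d | ∃ ε : γ.Latent X i → ℝ, ∑ g, ε g = 0 ∧
    Tendsto (fun η => γ.diffQuot X i ε η) (𝓝[>] 0) (𝓝 d)}
  zero_mem' := by
    refine ⟨0, by simp, ?_⟩
    refine tendsto_const_nhds.congr' ?_
    filter_upwards [self_mem_nhdsWithin] with η hη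
    rw [γ.diffQuot_eq X i 0 (ne_of_gt hη)]
    funext x
    simp
  add_mem' := by
    rintro d d' ⟨ε, h0, h⟩ ⟨ε', h0', h'⟩
    refine ⟨ε + ε', by simp [Finset.sum_add_distrib, h0, h0'], (h.add h').congr' ?_⟩
    filter_upwards [self_mem_nhdsWithin] with η hη
    simp only [γ.diffQuot_eq X i _ (ne_of_gt hη)]
    funext x
    simp [Finset.sum_add_distrib]
  smul_mem' := by
    rintro c d ⟨ε, h0, h⟩
    refine ⟨c • ε, by simp [← Finset.mul_sum, h0], (h.const_smul c).congr' ?_⟩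
    filter_upwards [self_mem_nhdsWithin] with η hη
    simp only [γ.diffQuot_eq X i _ (ne_of_gt hη)]
    funext x
    simp [Finset.mul_sum]

end Gearing

end MDAG

/-!
The spaces `Λ_A` are pairwise orthogonal for the standard inner product on functions of the joint
state (`Lam.sum_mul_eq_zero`), which gives directness (`iSupIndep_Lam`).

For the inclusion, the only property of an intrinsic set `S` that matters is that it is nonempty and
bidirected-connected in `G`: for every such `S` and every `A` with `sterile(S) ⊆ A ⊆ S ∪ pa(S)`, the
space `Λ_A` lies in the span of the `T_i` (`Gearing.Lam_le_iSup_T`).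

By the running intersection property, every vertex `a` of `S` outside the first remainder set `R i`
that `S` meets lies in `π(b)` for some `b ∈ S`, so that `f_a` is an argument of `f_b`
(`Gearing.exists_mem_π`). Choosing one such `b` for each `a` makes `S` a forest rooted in `R i`.
Given factors `c_v(x_{pa(v)}, x_v)`, `v ∈ S`, that sum to zero over `x_v`, put recursively
`Ψ_v(f_v) = ∑_{y, g} c_v(y, f_v(y, g)) ∏ Ψ_a(g_a)`, the product being over the children `a` of `v`.
Under the uniform distribution the values of `f_v` at different arguments are independent, so
conditionally on `f_v(x_{pa(v)}, f_{π(v)}) = x_v` all terms but the one at the actual arguments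
average to zero. Eliminating the functions `f_v` one at a time, always one that is not an argument of
those that are left (`Gearing.Forest.sum_prod_roots`), shows that the derivative in the direction
`ε = ∏ Ψ_v`, the product being over the roots, is a nonzero multiple of `∏_{v ∈ S} c_v`
(`Gearing.Forest.prod_mem_T`).

Finally `Λ_A` is spanned by products of functions `h_a(x_a)` of single coordinates
(`Lam.eq_sum_prod_lamKernel`), and these have the form `∏_{v ∈ S} c_v`
(`Gearing.prod_mem_iSup_T`): a vertex `v ∈ S` with a child in `S` may be given a factor without zeros
that sums to zero, and the factor of a child of `v` in `S` divides it out again, inserting `h_v`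
instead.
-/

/-! ### Resampling coordinates of a product -/

/-- Resampling one coordinate of a product: summing over all `f` and over all new values of the
`i`-th coordinate counts every element of the product once for each value of that coordinate. -/
theorem Fintype.card_mul_sum_eq_sum_update {ι R : Type*} [Fintype ι] [DecidableEq ι] [Semiring R]
    {F : ι → Type*} [∀ i, Fintype (F i)] (i : ι) (h : (∀ j, F j) → R) :
    (Fintype.card (F i) : R) * ∑ f, h f = ∑ f, ∑ y, h (Function.update f i y) := by
  rw [← Fintype.sum_prod_type' (f := fun f y => h (Function.update f i y))]
  let e : (∀ j, F j) × F i ≃ (∀ j, F j) × F i :=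
    { toFun := fun p => (Function.update p.1 i p.2, p.1 i)
      invFun := fun p => (Function.update p.1 i p.2, p.1 i)
      left_inv := fun p => by simp
      right_inv := fun p => by simp }
  rw [Fintype.sum_equiv e (fun p => h (Function.update p.1 i p.2)) (fun p => h p.1) fun p => rfl,
    Fintype.sum_prod_type]
  simp [Finset.mul_sum]

/-- Among the functions with a prescribed value at one point, the value at any other point is
equidistributed; so a statistic `c` that averages to zero contributes only at the prescribed
point. -/
theorem Fintype.sum_ite_apply_eq_mul_sum {α β : Type*} [Fintype α] [Fintype β] [DecidableEq α]
    [DecidableEq β] (a : α) (z : β) (c : α → β → ℝ) (hc : ∀ b, ∑ y, c b y = 0) :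
    (Fintype.card β : ℝ) * ∑ f : α → β, (if f a = z then ∑ b, c b (f b) else 0) =
      Fintype.card (α → β) * c a z := by
  have h1 : ∀ f : α → β, (if f a = z then ∑ b, c b (f b) else 0) =
      ∑ b, if f a = z then c b (f b) else 0 := by
    intro f
    split_ifs <;> simp
  have h2 : ∀ b, (Fintype.card β : ℝ) * ∑ f : α → β, (if f a = z then c b (f b) else 0) =
      if b = a then Fintype.card (α → β) * c a z else 0 := by
    intro b
    rw [Fintype.card_mul_sum_eq_sum_update (F := fun _ : α => β) b]
    split_ifs with hb
    · subst hb
      simp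
    · rw [Finset.sum_eq_zero]
      intro f _
      simp only [Function.update_of_ne (Ne.symm hb), Function.update_self]
      split_ifs
      · exact hc b
      · simp
  simp_rw [h1]
  rw [Finset.sum_comm, Finset.mul_sum]
  simp_rw [h2]
  simp

theorem Fintype.sum_ite_apply_eq {α β : Type*} [Fintype α] [Fintype β] [DecidableEq α]
    [DecidableEq β] (a : α) (z : β) :
    (Fintype.card β : ℝ) * ∑ f : α → β, (if f a = z then 1 else 0) = Fintype.card (α → β) := by
  rw [Fintype.card_mul_sum_eq_sum_update (F := fun _ : α => β) a]
  simp

theorem Fintype.exists_sum_eq_zero_forall_ne_zero (β : Type*) [Fintype β] [Nontrivial β] :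
    ∃ u : β → ℝ, ∑ y, u y = 0 ∧ ∀ y, u y ≠ 0 := by
  classical
  obtain ⟨y₀⟩ : Nonempty β := inferInstance
  have h2 : (2 : ℝ) ≤ Fintype.card β := by exact_mod_cast Fintype.one_lt_card (α := β)
  refine ⟨fun y => if y = y₀ then 1 - Fintype.card β else 1, ?_, fun y => ?_⟩
  · have : ∀ y, (if y = y₀ then (1 - Fintype.card β : ℝ) else 1) =
        1 - if y = y₀ then (Fintype.card β : ℝ) else 0 := by
      intro y
      split_ifs <;> simp
    simp [this]
  · dsimp only
    split_ifs
    · linarith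
    · exact one_ne_zero

namespace MDAG

variable {ι : Type u} [DecidableEq ι]

/-! ### The spaces `Λ_A` -/

section Lam

variable {X : ι → Type w} [∀ v, Fintype (X v)] {D A B : Finset ι}

/-- Summing the product first over a coordinate that lies in one of the two sets only gives zero. -/
theorem Lam.sum_mul_eq_zero_of_mem {p q : State X D → ℝ} (hp : p ∈ Lam X D A)
    (hq : q ∈ Lam X D B) {a : ι} (haD : a ∈ D) (haA : a ∈ A) (haB : a ∉ B) :
    ∑ x, p x * q x = 0 := by
  rcases isEmpty_or_nonempty (State X D) with hE | ⟨⟨x₀⟩⟩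
  · simp
  have hne : (Fintype.card (X a) : ℝ) ≠ 0 := by
    have : Nonempty (X a) := ⟨x₀ ⟨a, haD⟩⟩
    exact_mod_cast Fintype.card_ne_zero
  refine (mul_eq_zero.1 ?_).resolve_left hne
  rw [Fintype.card_mul_sum_eq_sum_update (F := fun v : D => X v) ⟨a, haD⟩]
  refine Finset.sum_eq_zero fun x _ => ?_
  have : ∀ y, q (Function.update x ⟨a, haD⟩ y) = q x := fun y =>
    hq.2 _ _ fun b hb => Function.update_of_ne (fun h => haB (by rw [h] at hb; exact hb)) _ _
  simp_rw [this, ← Finset.sum_mul]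
  rw [hp.1 ⟨a, haD⟩ haA x, zero_mul]

theorem Lam.sum_mul_eq_zero {p q : State X D → ℝ} (hp : p ∈ Lam X D A) (hq : q ∈ Lam X D B)
    (hA : A ⊆ D) (hB : B ⊆ D) (hAB : A ≠ B) : ∑ x, p x * q x = 0 := by
  by_cases h : A ⊆ B
  · obtain ⟨b, hbB, hbA⟩ := Finset.not_subset.1 fun h' => hAB (h.antisymm h')
    simp_rw [mul_comm (p _)]
    exact sum_mul_eq_zero_of_mem hq hp (hB hbB) hbB hbA
  · obtain ⟨a, haA, haB⟩ := Finset.not_subset.1 h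
    exact sum_mul_eq_zero_of_mem hp hq (hA haA) haA haB

/-- The spaces `Λ_A` are pairwise orthogonal, hence independent. -/
theorem iSupIndep_Lam (𝒜 : Set (Finset ι)) (h𝒜 : ∀ A ∈ 𝒜, A ⊆ D) :
    iSupIndep fun A : 𝒜 => Lam X D (A : Finset ι) := by
  intro A
  rw [Submodule.disjoint_def]
  intro p hp hp'
  have hle : (⨆ B : 𝒜, ⨆ _ : B ≠ A, Lam X D (B : Finset ι)) ≤
      LinearMap.ker (∑ x, p x • (LinearMap.proj x : (State X D → ℝ) →ₗ[ℝ] ℝ)) := by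
    refine iSup₂_le fun B hB q hq => ?_
    simpa using Lam.sum_mul_eq_zero hp hq (h𝒜 A A.2) (h𝒜 B B.2) fun h => hB (Subtype.ext h.symm)
  have h0 : ∑ x, p x * p x = 0 := by simpa using hle hp'
  funext x
  exact mul_self_eq_zero.1
    ((Finset.sum_eq_zero_iff_of_nonneg fun x _ => mul_self_nonneg (p x)).1 h0 x (Finset.mem_univ x))

open Classical in
/-- The kernel that reproduces `Λ_A` in the coordinate `a`: the centred indicator `[y = z] - 1/|𝔛_a|`
for `a ∈ A`, and the constant `1/|𝔛_a|` for `a ∉ A`. -/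
noncomputable def lamKernel (X : ι → Type w) [∀ v, Fintype (X v)] (A : Finset ι) (a : ι)
    (z y : X a) : ℝ :=
  if a ∈ A then (if y = z then 1 else 0) - (Fintype.card (X a) : ℝ)⁻¹
  else (Fintype.card (X a) : ℝ)⁻¹

theorem sum_lamKernel {a : ι} (ha : a ∈ A) (z : X a) : ∑ y, lamKernel X A a z y = 0 := by
  have hne : (Fintype.card (X a) : ℝ) ≠ 0 := by
    have : Nonempty (X a) := ⟨z⟩
    exact_mod_cast Fintype.card_ne_zero
  classical
  simp [lamKernel, ha, hne]

/-- Every element of `Λ_A` is a combination of products of functions of single coordinates. -/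
theorem Lam.eq_sum_prod_lamKernel {p : State X D → ℝ} (hp : p ∈ Lam X D A) (x : State X D) :
    p x = ∑ z : State X D, p z * ∏ a : D, lamKernel X A a (z a) (x a) := by
  classical
  -- The kernels replace the indicators `[x a = z a]` one coordinate at a time.
  have key : ∀ t : Finset D, p x = ∑ z : State X D, p z *
      ((∏ a ∈ t, lamKernel X A a (z a) (x a)) * ∏ a ∈ tᶜ, if x a = z a then 1 else 0) := by
    intro t
    induction t using Finset.induction_on with
    | empty =>
      rw [Finset.sum_eq_single x]
      · simp
      · intro z _ hz
        obtain ⟨a, ha⟩ := Function.ne_iff.1 hz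
        have h0 : ∏ a ∈ (∅ : Finset D)ᶜ, (if x a = z a then (1 : ℝ) else 0) = 0 :=
          Finset.prod_eq_zero (i := a) (by simp) (by simpa using Ne.symm ha)
        rw [h0, mul_zero, mul_zero]
      · simp
    | insert a t hat ih =>
      have hne : (Fintype.card (X a) : ℝ) ≠ 0 := by
        have : Nonempty (X a) := ⟨x a⟩
        exact_mod_cast Fintype.card_ne_zero
      have hc : tᶜ = insert a (insert a t)ᶜ := by
        ext b
        by_cases hb : b = a <;> simp [hb, hat]
      rw [ih]
      refine mul_left_cancel₀ hne ?_
      rw [Fintype.card_mul_sum_eq_sum_update (F := fun v : D => X v) a,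
        Fintype.card_mul_sum_eq_sum_update (F := fun v : D => X v) a]
      refine Finset.sum_congr rfl fun z _ => ?_
      have h1 : ∀ y : X a, ∏ b ∈ t, lamKernel X A b (Function.update z a y b) (x b) =
          ∏ b ∈ t, lamKernel X A b (z b) (x b) := fun y => Finset.prod_congr rfl fun b hb => by
        rw [Function.update_of_ne (ne_of_mem_of_not_mem hb hat)]
      have h2 : ∀ y : X a, (∏ b ∈ (insert a t)ᶜ,
          if x b = Function.update z a y b then (1 : ℝ) else 0) =
          ∏ b ∈ (insert a t)ᶜ, if x b = z b then 1 else 0 := fun y =>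
        Finset.prod_congr rfl fun b hb => by
          rw [Function.update_of_ne]
          rintro rfl
          simp at hb
      have h3 : ∑ y, p (Function.update z a y) * lamKernel X A a y (x a) =
          ∑ y, p (Function.update z a y) * if x a = y then 1 else 0 := by
        by_cases ha : (a : ι) ∈ A
        · simp only [lamKernel, ha, if_true, mul_sub, Finset.sum_sub_distrib, ← Finset.sum_mul,
            hp.1 a ha z]
          simp
        · have : ∀ y, p (Function.update z a y) = p z := fun y =>
            hp.2 _ _ fun b hb => Function.update_of_ne (fun h => ha (by rw [h] at hb; exact hb)) _ _
          simp [lamKernel, ha, this, hne, mul_left_comm]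
      simp_rw [Finset.prod_insert hat, hc]
      simp_rw [Finset.prod_insert (show a ∉ (insert a t)ᶜ by simp), h1, h2, Function.update_self]
      set α := ∏ b ∈ t, lamKernel X A b (z b) (x b)
      set β := ∏ b ∈ (insert a t)ᶜ, if x b = z b then (1 : ℝ) else 0
      calc _ = (∑ y, p (Function.update z a y) * if x a = y then 1 else 0) * (α * β) := by
            rw [Finset.sum_mul]
            exact Finset.sum_congr rfl fun y _ => by ring
        _ = _ := by
            rw [← h3, Finset.sum_mul]
            exact Finset.sum_congr rfl fun y _ => by ring
  simpa only [Finset.compl_univ, Finset.prod_empty, mul_one] using key Finset.univ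

end Lam

/-! ### Intrinsic sets are connected -/

section Intrinsic

variable {G : MDAG ι}

theorem exists_mem_superset_of_mem_traceEdges {D e : Finset ι} (he : e ∈ G.traceEdges D) :
    ∃ e' ∈ G.B, e ⊆ e' := by
  simp only [traceEdges, Finset.mem_filter, Finset.mem_image] at he
  obtain ⟨⟨⟨e', he', rfl⟩, -⟩, -⟩ := he
  exact ⟨e', he', Finset.inter_subset_left⟩

theorem Reaches.subset {H : MDAG ι} (h : G.Reaches H) :
    H.V ⊆ G.V ∧ ∀ e ∈ H.B, ∃ e' ∈ G.B, e ⊆ e' := by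
  induction h with
  | refl => exact ⟨subset_rfl, fun e he => ⟨e, he, subset_rfl⟩⟩
  | district h hD ih =>
    refine ⟨hD.2.prop.1.trans ih.1, fun e he => ?_⟩
    obtain ⟨e', he', h1⟩ := exists_mem_superset_of_mem_traceEdges he
    obtain ⟨e'', he'', h2⟩ := ih.2 e' he'
    exact ⟨e'', he'', h1.trans h2⟩
  | remove h hv hch ih =>
    refine ⟨(Finset.erase_subset _ _).trans ih.1, fun e he => ?_⟩
    obtain ⟨e', he', h1⟩ := exists_mem_superset_of_mem_traceEdges he
    obtain ⟨e'', he'', h2⟩ := ih.2 e' he'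
    exact ⟨e'', he'', h1.trans h2⟩

theorem IsIntrinsic.nonempty_and_isBiConnected {S : Finset ι} (hS : G.IsIntrinsic S) :
    S.Nonempty ∧ G.IsBiConnected S := by
  obtain ⟨H, hH, hne, hmax⟩ := hS
  have hsub := hH.subset
  refine ⟨hne, hmax.prop.1.trans hsub.1, fun a ha b hb => ?_⟩
  refine Relation.ReflTransGen.mono ?_ _ _ (hmax.prop.2 a ha b hb)
  rintro c d ⟨hc, hd, e, he, hce, hde⟩
  obtain ⟨e', he', h⟩ := hsub.2 e he
  exact ⟨hc, hd, e', he', h hce, h hde⟩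

theorem paSet_subset_verts (S : Finset ι) : G.paSet S ⊆ G.verts :=
  Finset.biUnion_subset.2 fun v _ => G.pa_subset v

end Intrinsic

/-! ### Connected sets along a gearing -/

namespace Gearing

variable {G : MDAG ι} {k : ℕ} (γ : G.Gearing k)

theorem exists_mem_R {v : ι} {j : Fin k} (hv : v ∈ γ.B j) : ∃ i, v ∈ γ.R i ∧ i ≤ j := by
  classical
  induction j using WellFoundedLT.induction with
  | ind j ih =>
    by_cases h : v ∈ (Finset.univ.filter (· < j)).biUnion γ.B
    · obtain ⟨i, hi, hvi⟩ := Finset.mem_biUnion.1 h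
      have hij : i < j := by simpa using hi
      obtain ⟨l, hl, hli⟩ := ih i hij hvi
      exact ⟨l, hl, hli.trans hij.le⟩
    · exact ⟨j, Finset.mem_sdiff.2 ⟨hv, h⟩, le_rfl⟩

theorem R_subset_B (j : Fin k) : γ.R j ⊆ γ.B j := Finset.sdiff_subset

theorem mem_π {v a : ι} {i j : Fin k} (hv : v ∈ γ.R i) (hij : i < j) (hvj : v ∈ γ.B j)
    (ha : a ∈ γ.R j) : a ∈ γ.π v := by
  refine Finset.mem_biUnion.2 ⟨j, ?_, ha⟩
  simpa [γ.r_eq hv] using ⟨hij, hvj⟩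

theorem notMem_π_self (v : ι) : v ∉ γ.π v := fun h => lt_irrefl _ (γ.sub_r_lt h)

/-- The index `l` lies at or below `j` when each index `m` hangs below `s m`; with `s m` the earlier
index that the running intersection property gives for `m > 0`, this is the order of a rooted
forest on the bidirected edges. -/
def Below (s : Fin k → Fin k) (j l : Fin k) : Prop := ∃ n, s^[n] l = j

/-- A connected set that meets `R j` and some earlier remainder set meets `B j` in a vertex of an
earlier remainder set: the vertices whose remainder sets lie at or below `j` in the forest can be
left only through `B j ∩ B (s j)`. -/
theorem exists_mem_π {S : Finset ι} (hS : G.IsBiConnected S) {i j : Fin k} (hij : i < j)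
    {v a : ι} (hv : v ∈ S) (hvi : v ∈ γ.R i) (ha : a ∈ S) (haj : a ∈ γ.R j) :
    ∃ b ∈ S, a ∈ γ.π b := by
  have hs : ∀ j : Fin k, ∃ s ≤ j, 0 < (j : ℕ) →
      s < j ∧ γ.B j ∩ (Finset.univ.filter (· < j)).biUnion γ.B = γ.B j ∩ γ.B s := by
    intro j
    by_cases h : 0 < (j : ℕ)
    · obtain ⟨s, hs⟩ := γ.running j h
      exact ⟨s, hs.1.le, fun _ => hs⟩
    · exact ⟨j, le_rfl, fun h' => absurd h' h⟩
  choose s hsle hs using hs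
  by_contra! hcon
  -- A vertex of an edge that is not in its remainder set also lies in the edge above.
  have up : ∀ (l m : Fin k) (u : ι), u ∈ γ.R m → u ∈ γ.B l → m < l → s l < l ∧ u ∈ γ.B (s l) := by
    intro l m u hm hl hml
    obtain ⟨h1, h2⟩ := hs l (by omega)
    refine ⟨h1, (Finset.mem_inter.1 (h2 ▸ Finset.mem_inter.2 ⟨hl, ?_⟩ : u ∈ γ.B l ∩ γ.B (s l))).2⟩
    exact Finset.mem_biUnion.2 ⟨m, by simpa using hml, γ.R_subset_B m hm⟩
  have rle : ∀ (l m : Fin k) (u : ι), u ∈ γ.R m → u ∈ γ.B l → m ≤ l := by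
    intro l m u hm hl
    obtain ⟨i, hi, hil⟩ := γ.exists_mem_R hl
    exact γ.R_unique hm hi ▸ hil
  have climb : ∀ (l m : Fin k) (u : ι), u ∈ γ.R m → u ∈ γ.B l → Below s m l := by
    intro l
    induction l using WellFoundedLT.induction with
    | ind l ih =>
      intro m u hm hl
      rcases (rle l m u hm hl).eq_or_lt with rfl | hml
      · exact ⟨0, rfl⟩
      · obtain ⟨h1, h2⟩ := up l m u hm hl hml
        obtain ⟨n, hn⟩ := ih _ h1 m u hm h2
        exact ⟨n + 1, hn⟩
  have stay : ∀ (l m : Fin k) (u : ι), u ∈ S → u ∈ γ.R m → u ∈ γ.B l → Below s j l →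
      Below s j m := by
    intro l
    induction l using WellFoundedLT.induction with
    | ind l ih =>
      intro m u hu hm hl hjl
      rcases (rle l m u hm hl).eq_or_lt with rfl | hml
      · exact hjl
      · obtain ⟨h1, h2⟩ := up l m u hm hl hml
        obtain ⟨n, hn⟩ := hjl
        rcases n with _ | n
        · obtain rfl : l = j := hn
          exact absurd (γ.mem_π hm hml hl haj) (hcon u hu)
        · exact ih _ h1 m u hu hm h2 ⟨n, hn⟩
  have hall : ∀ b, Relation.ReflTransGen
      (fun c d => c ∈ S ∧ d ∈ S ∧ ∃ e ∈ G.B, c ∈ e ∧ d ∈ e) a b →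
      ∃ m, b ∈ γ.R m ∧ Below s j m := by
    intro b hb
    induction hb with
    | refl => exact ⟨j, haj, 0, rfl⟩
    | @tail c d _ hcd ih =>
      obtain ⟨m, hcm, n, hn⟩ := ih
      obtain ⟨hc, hd, e, he, hce, hde⟩ := hcd
      obtain ⟨l, rfl⟩ := (γ.mem_iff e).1 he
      obtain ⟨n', hn'⟩ := climb l m c hcm hce
      obtain ⟨m', hdm', -⟩ := γ.exists_mem_R hde
      refine ⟨m', hdm', stay l m' d hd hdm' hde ⟨n + n', ?_⟩⟩
      rw [Function.iterate_add_apply, hn', hn]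
  obtain ⟨m, hm, n, hn⟩ := hall v (hS.2 a ha v hv)
  obtain rfl := γ.R_unique hvi hm
  exact absurd (hn ▸ Function.iterate_le_id_of_le_id hsle n i) (not_le.2 hij)

/-- A choice of parents that makes the set `S` of random vertices a forest along the gearing: a
vertex of `S` without parent lies in `R i`, and every other vertex of `S` has a parent `b` in `S`
whose structural function `f_b` takes `f_v` as an argument. -/
structure Forest (S : Finset ι) (i : Fin k) where
  par : ι → Option ι
  mem_R : ∀ v ∈ S, par v = none → v ∈ γ.R i
  par_eq_none : ∀ v ∈ γ.R i, par v = none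
  mem_of_par : ∀ v b, par v = some b → b ∈ S ∧ v ∈ γ.π b

/-- A connected set is a forest along the gearing, with roots in the first remainder set that it
meets. -/
theorem exists_forest (hG : ∀ v ∈ G.V, ∃ e ∈ G.B, v ∈ e) {S : Finset ι} (hne : S.Nonempty)
    (hS : G.IsBiConnected S) : ∃ i : Fin k, (∃ v ∈ S, v ∈ γ.R i) ∧ Nonempty (γ.Forest S i) := by
  have hR : ∀ v ∈ S, ∃ j, v ∈ γ.R j := by
    intro v hv
    obtain ⟨e, he, hve⟩ := hG v (hS.1 hv)
    obtain ⟨j, rfl⟩ := (γ.mem_iff e).1 he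
    exact (γ.exists_mem_R hve).imp fun _ h => h.1
  obtain ⟨v₀, hv₀⟩ := hne
  obtain ⟨i, ⟨v, hv, hvi⟩, hmin⟩ := WellFounded.has_min (wellFounded_lt (α := Fin k))
    {j | ∃ v ∈ S, v ∈ γ.R j} ((hR v₀ hv₀).imp fun j hj => ⟨v₀, hv₀, hj⟩)
  have hpar : ∀ a, ∃ o : Option ι, (a ∈ S → o = none → a ∈ γ.R i) ∧
      (a ∈ γ.R i → o = none) ∧ (∀ b, o = some b → b ∈ S ∧ a ∈ γ.π b) := by
    intro a
    by_cases ha : a ∈ S ∧ a ∉ γ.R i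
    · obtain ⟨j, hj⟩ := hR a ha.1
      have hij : i < j := by
        refine lt_of_le_of_ne (not_lt.1 (hmin j ⟨a, ha.1, hj⟩)) ?_
        rintro rfl
        exact ha.2 hj
      obtain ⟨b, hb, hab⟩ := γ.exists_mem_π hS hij hv hvi ha.1 hj
      refine ⟨some b, by simp, fun h => absurd h ha.2, fun c hc => ?_⟩
      obtain rfl : b = c := by simpa using hc
      exact ⟨hb, hab⟩
    · exact ⟨none, fun haS _ => by tauto, fun _ => rfl, by simp⟩
  choose par h1 h2 h3 using hpar
  exact ⟨i, ⟨v, hv, hvi⟩, ⟨⟨par, h1, h2, h3⟩⟩⟩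

/-! ### Derivatives that factor over a forest -/

variable (X : ι → Type w)

/-- The arguments `𝔛_{pa(v)} × ℱ_{π(v)}` of the structural functions of `v`. -/
abbrev Args (v : ι) : Type (max u w) := State X (G.pa v) × (∀ a : γ.π v, γ.Fn X a)

/-- The elements of `ℱ_v` as functions of one argument. -/
noncomputable def uncurryEquiv (v : ι) : γ.Fn X v ≃ (γ.Args X v → X v) :=
  (γ.fnEquiv X v).trans (Equiv.curry _ _ _).symm

variable {X} in
/-- The arguments at which `f_v` is evaluated, for the state `x` and the functions `f`. -/
noncomputable def args (x : State X G.verts) (f : ∀ v : G.V, γ.Fn X v) (v : G.V) : γ.Args X v :=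
  (Finset.restrict₂ (G.pa_subset v) x, Finset.restrict₂ (π := γ.Fn X) (γ.π_subset v) f)

variable {X} in
theorem evaluates_iff (f : ∀ v : G.V, γ.Fn X v) (x : State X G.verts) : γ.Evaluates X f x ↔
    ∀ v : G.V, γ.uncurryEquiv X v (f v) (γ.args x f v) = x ⟨v, Finset.mem_union_left _ v.2⟩ :=
  Iff.rfl

variable {X} in
theorem args_update_of_notMem (x : State X G.verts) (f : ∀ v : G.V, γ.Fn X v) {v u : G.V}
    (h : (v : ι) ∉ γ.π u) (g : γ.Fn X v) : γ.args x (Function.update f v g) u = γ.args x f u := by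
  refine Prod.ext rfl (funext fun a => Function.update_of_ne ?_ _ _)
  rintro rfl
  exact h a.2

namespace Forest

variable [∀ v, Fintype (X v)]

variable {γ X} {S : Finset ι} {i : Fin k} (F : γ.Forest S i)
  (c : ∀ v, State X (G.pa v) → X v → ℝ)

open Classical in
/-- The statistic of `f_v` that reproduces the factor `c_v` at a vertex `v` of the forest and,
through the arguments of `f_v`, the statistics of the children of `v`:
`Ψ_v(f_v) = ∑_{y, g} c_v(y, f_v(y, g)) ∏_{par a = v} Ψ_a(g_a)`. It is `1` outside the forest. -/
noncomputable def stat {S : Finset ι} {i : Fin k} (F : γ.Forest S i)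
    (c : ∀ v, State X (G.pa v) → X v → ℝ) (v : ι) (f : γ.Fn X v) : ℝ :=
  if v ∈ S then ∑ b : γ.Args X v, c v b.1 (γ.uncurryEquiv X v f b) *
    ∏ a : γ.π v, if F.par a = some v then F.stat c a (b.2 a) else 1
  else 1
termination_by k - γ.r v
decreasing_by exact γ.sub_r_lt a.2

/-- The children of `v` in the forest. -/
def children (v : ι) : Finset G.V := Finset.univ.filter fun a => F.par a = some v

/-- The roots of the restriction of the forest to `U`. -/
def roots (U : Finset G.V) : Finset G.V := U.filter fun a => ∀ b ∈ U, F.par a ≠ some (b : ι)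

theorem children_eq_empty {v : ι} (hv : v ∉ S) : F.children v = ∅ :=
  Finset.filter_eq_empty_iff.2 fun _ _ ha => hv (F.mem_of_par _ _ ha).1

theorem prod_children (v : G.V) (f : ∀ v : G.V, γ.Fn X v) (x : State X G.verts) :
    (∏ a : γ.π v, if F.par a = some (v : ι) then F.stat c a ((γ.args x f v).2 a) else 1) =
      ∏ a ∈ F.children v, F.stat c a (f a) := by
  rw [children, Finset.prod_filter]
  refine Fintype.prod_of_injective (fun a : γ.π v => (⟨a, γ.π_subset v a.2⟩ : G.V))
    (fun a b h => Subtype.ext (congrArg (fun z : G.V => (z : ι)) h)) _ _ (fun a ha => ?_)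
    fun a => rfl
  rw [if_neg]
  exact fun h => ha ⟨⟨a, (F.mem_of_par _ _ h).2⟩, rfl⟩

open Classical in
/-- The sum over the structural functions of one vertex `v`, given those of the vertices in
`π(v)`. -/
theorem card_mul_sum_stat (hc : ∀ v ∈ S, ∀ y, ∑ z, c v y z = 0) (v : G.V)
    (f : ∀ v : G.V, γ.Fn X v) (x : State X G.verts) (z : X v) :
    (Fintype.card (X v) : ℝ) *
        ∑ g, (if γ.uncurryEquiv X v g (γ.args x f v) = z then F.stat c v g else 0) =
      Fintype.card (γ.Fn X v) * ((if (v : ι) ∈ S then c v (γ.args x f v).1 z else 1) *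
        ∏ a ∈ F.children v, F.stat c a (f a)) := by
  rw [Fintype.card_congr (γ.uncurryEquiv X v),
    ← Equiv.sum_comp (γ.uncurryEquiv X v).symm]
  simp only [Equiv.apply_symm_apply]
  by_cases hv : (v : ι) ∈ S
  · rw [if_pos hv, ← F.prod_children c v f x]
    rw [← Fintype.sum_ite_apply_eq_mul_sum (γ.args x f v) z (fun b z => c v b.1 z *
      ∏ a : γ.π v, if F.par a = some (v : ι) then F.stat c a (b.2 a) else 1)]
    · congr 1
      refine Finset.sum_congr rfl fun g _ => ?_
      rw [stat, if_pos hv, Equiv.apply_symm_apply]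
    · intro b
      rw [← Finset.sum_mul, hc v hv, zero_mul]
  · rw [if_neg hv, F.children_eq_empty hv, Finset.prod_empty, mul_one, mul_one,
      ← Fintype.sum_ite_apply_eq (γ.args x f v) z]
    congr 1
    refine Finset.sum_congr rfl fun g _ => ?_
    rw [stat, if_neg hv]

theorem sum_stat_eq_zero (hc : ∀ v ∈ S, ∀ y, ∑ z, c v y z = 0) {v : ι} (hv : v ∈ S)
    [Nonempty (X v)] : ∑ f, F.stat c v f = 0 := by
  classical
  have hne : (Fintype.card (X v) : ℝ) ≠ 0 := by exact_mod_cast Fintype.card_ne_zero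
  have hstat : ∀ g, F.stat c v ((γ.uncurryEquiv X v).symm g) = ∑ b, c v b.1 (g b) *
      ∏ a : γ.π v, if F.par a = some v then F.stat c a (b.2 a) else 1 := by
    intro g
    rw [stat, if_pos hv, Equiv.apply_symm_apply]
  rw [← Equiv.sum_comp (γ.uncurryEquiv X v).symm]
  simp_rw [hstat]
  rw [Finset.sum_comm]
  refine Finset.sum_eq_zero fun b _ => ?_
  refine (mul_eq_zero.1 ?_).resolve_left hne
  rw [Fintype.card_mul_sum_eq_sum_update (F := fun _ : γ.Args X v => X v) b]
  refine Finset.sum_eq_zero fun f _ => ?_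
  simp only [Function.update_self]
  rw [← Finset.sum_mul, hc v hv, zero_mul]

theorem mem_roots {U : Finset G.V} {v : G.V} (hv : v ∈ U)
    (hmin : ∀ u ∈ U, (v : ι) ∉ γ.π u) : v ∈ F.roots U :=
  Finset.mem_filter.2 ⟨hv, fun u hu h => hmin u hu (F.mem_of_par _ _ h).2⟩

/-- When `v` is removed from `U`, its place among the roots is taken by its children. -/
theorem roots_erase {U : Finset G.V} {v : G.V} (hU : ∀ a : G.V, (a : ι) ∈ γ.π v → a ∈ U) :
    F.roots (U.erase v) = (F.roots U).erase v ∪ F.children v := by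
  ext a
  simp only [roots, children, Finset.mem_filter, Finset.mem_erase, Finset.mem_union,
    Finset.mem_univ, true_and]
  constructor
  · rintro ⟨⟨hav, haU⟩, h⟩
    by_cases hp : F.par a = some (v : ι)
    · exact Or.inr hp
    · refine Or.inl ⟨hav, haU, fun b hb => ?_⟩
      by_cases hbv : b = v
      · exact hbv ▸ hp
      · exact h b ⟨hbv, hb⟩
  · rintro (⟨hav, haU, h⟩ | hp)
    · exact ⟨⟨hav, haU⟩, fun b hb => h b hb.2⟩
    · have haπ := (F.mem_of_par _ _ hp).2
      refine ⟨⟨?_, hU a haπ⟩, fun b hb h => hb.1 ?_⟩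
      · rintro rfl
        exact γ.notMem_π_self _ haπ
      · exact Subtype.ext (Option.some.inj (h.symm.trans hp))

theorem disjoint_children {U : Finset G.V} {v : G.V} (hv : v ∈ U) :
    Disjoint ((F.roots U).erase v) (F.children v) := by
  rw [Finset.disjoint_left]
  intro a ha ha'
  exact (Finset.mem_filter.1 (Finset.mem_of_mem_erase ha)).2 v hv (Finset.mem_filter.1 ha').2

open Classical in
/-- Elimination of the structural functions of the vertices in `U`, starting with those that are
not arguments of other functions. -/
theorem sum_prod_roots (hc : ∀ v ∈ S, ∀ y, ∑ z, c v y z = 0) (x : State X G.verts)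
    (hX : ∀ v : G.V, Nonempty (X v)) (U : Finset G.V)
    (hU : ∀ u ∈ U, ∀ a : G.V, (a : ι) ∈ γ.π u → a ∈ U) :
    (∏ v ∈ U, (Fintype.card (X v) : ℝ)) * ∑ f : (∀ v : G.V, γ.Fn X v),
        (∏ v ∈ U, if γ.uncurryEquiv X v (f v) (γ.args x f v) =
          x ⟨v, Finset.mem_union_left _ v.2⟩ then 1 else 0) *
        ∏ v ∈ F.roots U, F.stat c v (f v) =
      Fintype.card (∀ v : G.V, γ.Fn X v) * ∏ v ∈ U, if (v : ι) ∈ S then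
        c v (Finset.restrict₂ (G.pa_subset v) x) (x ⟨v, Finset.mem_union_left _ v.2⟩) else 1 := by
  induction hn : U.card generalizing U with
  | zero =>
    obtain rfl := Finset.card_eq_zero.1 hn
    simp [roots]
  | succ n ih =>
    -- The indices `r` increase from `u` to `π(u)`, so a vertex of `U` with minimal `r` is not an
    -- argument within `U`; the truncated `k - r` turns this into a maximum.
    obtain ⟨v, hv, hmax⟩ := Finset.exists_max_image U (fun v => k - γ.r v)
      (Finset.card_pos.1 (by omega))
    have hmin : ∀ u ∈ U, (v : ι) ∉ γ.π u := fun u hu h =>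
      absurd (γ.sub_r_lt h) (not_lt.2 (hmax u hu))
    have hrec := ih (U.erase v) (fun u hu a ha => by
      refine Finset.mem_erase.2 ⟨?_, hU u (Finset.mem_of_mem_erase hu) a ha⟩
      rintro rfl
      exact hmin u (Finset.mem_of_mem_erase hu) ha) (by rw [Finset.card_erase_of_mem hv]; omega)
    have hne : (Fintype.card (γ.Fn X v) : ℝ) ≠ 0 := by
      have : Nonempty (γ.Fn X v) := ⟨(γ.uncurryEquiv X v).symm fun _ => (hX v).some⟩
      exact_mod_cast Fintype.card_ne_zero
    rw [← Finset.mul_prod_erase U _ hv, ← Finset.mul_prod_erase U (fun v => if (v : ι) ∈ S then _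
      else _) hv, mul_left_comm (Fintype.card _ : ℝ), ← hrec, mul_right_comm,
      mul_left_comm _ (∏ v ∈ U.erase v, (Fintype.card (X v) : ℝ)),
      mul_comm (∏ v ∈ U.erase v, (Fintype.card (X v) : ℝ))]
    congr 1
    refine mul_left_cancel₀ hne ?_
    rw [mul_left_comm, Fintype.card_mul_sum_eq_sum_update (F := fun v : G.V => γ.Fn X v) v]
    simp_rw [Finset.mul_sum]
    refine Finset.sum_congr rfl fun f _ => ?_
    -- Only the two factors that belong to `v` depend on `f_v`.
    have h1 : ∀ g : γ.Fn X v, (∏ u ∈ U.erase v,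
        if γ.uncurryEquiv X u (Function.update f v g u) (γ.args x (Function.update f v g) u) =
          x ⟨u, Finset.mem_union_left _ u.2⟩ then (1 : ℝ) else 0) =
        ∏ u ∈ U.erase v, if γ.uncurryEquiv X u (f u) (γ.args x f u) =
          x ⟨u, Finset.mem_union_left _ u.2⟩ then 1 else 0 := fun g =>
      Finset.prod_congr rfl fun u hu => by
        rw [γ.args_update_of_notMem x f (hmin u (Finset.mem_of_mem_erase hu)),
          Function.update_of_ne (Finset.ne_of_mem_erase hu)]
    have h2 : ∀ g : γ.Fn X v, (∏ u ∈ (F.roots U).erase v, F.stat c u (Function.update f v g u)) =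
        ∏ u ∈ (F.roots U).erase v, F.stat c u (f u) := fun g =>
      Finset.prod_congr rfl fun u hu => by
        rw [Function.update_of_ne (Finset.ne_of_mem_erase hu)]
    have hstep := F.card_mul_sum_stat c hc v f x (x ⟨v, Finset.mem_union_left _ v.2⟩)
    rw [roots_erase F (hU v hv), Finset.prod_union (F.disjoint_children hv)]
    simp_rw [← Finset.mul_prod_erase U _ hv, ← Finset.mul_prod_erase (F.roots U) _
      (F.mem_roots hv hmin), h1, h2, γ.args_update_of_notMem x f (γ.notMem_π_self v),
      Function.update_self]
    set α := ∏ u ∈ U.erase v, if γ.uncurryEquiv X u (f u) (γ.args x f u) =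
          x ⟨u, Finset.mem_union_left _ u.2⟩ then (1 : ℝ) else 0
    set β := ∏ u ∈ (F.roots U).erase v, F.stat c u (f u)
    calc _ = α * β * ((Fintype.card (X v) : ℝ) * ∑ g, (if γ.uncurryEquiv X v g (γ.args x f v) =
            x ⟨v, Finset.mem_union_left _ v.2⟩ then F.stat c v g else 0)) := by
          simp_rw [Finset.mul_sum]
          refine Finset.sum_congr rfl fun g _ => ?_
          split_ifs <;> ring
      _ = _ := by
          rw [hstep, args]
          ring

/-- The product over a forest of factors `c_v(x_{pa(v)}, x_v)` that sum to zero over `x_v` is a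
derivative with respect to the latent variable of the roots. -/
theorem prod_mem_T (F : γ.Forest S i) (hS : S ⊆ G.V) (hroot : ∃ v ∈ S, v ∈ γ.R i)
    (hX : ∀ v ∈ G.V, Nonempty (X v)) (hc : ∀ v ∈ S, ∀ y, ∑ z, c v y z = 0) :
    (fun x : State X G.verts => ∏ v : G.V, if (v : ι) ∈ S then
      c v (Finset.restrict₂ (G.pa_subset v) x) (x ⟨v, Finset.mem_union_left _ v.2⟩) else 1) ∈
      γ.T X i := by
  classical
  set q : State X G.verts → ℝ := fun x => ∏ v : G.V, if (v : ι) ∈ S then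
      c v (Finset.restrict₂ (G.pa_subset v) x) (x ⟨v, Finset.mem_union_left _ v.2⟩) else 1
  have hX' : ∀ v : G.V, Nonempty (X v) := fun v => hX v v.2
  let ε : γ.Latent X i → ℝ := fun g => ∏ v : γ.R i, F.stat c v (g v)
  have hε : ∑ g, ε g = 0 := by
    obtain ⟨v, hv, hvi⟩ := hroot
    have : Nonempty (X v) := hX v (hS hv)
    have h := Finset.prod_univ_sum (fun _ => Finset.univ) fun (v : γ.R i) (g : γ.Fn X v) =>
      F.stat c v g
    rw [Fintype.piFinset_univ] at h
    rw [← h]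
    exact Finset.prod_eq_zero (Finset.mem_univ ⟨v, hvi⟩) (F.sum_stat_eq_zero c hc hv)
  have hprod : ∀ f : (∀ v : G.V, γ.Fn X v), ε (Finset.restrict₂ (π := γ.Fn X) (γ.R_subset i) f) =
      ∏ v ∈ F.roots Finset.univ, F.stat c v (f v) := by
    intro f
    rw [roots, Finset.prod_filter]
    refine Fintype.prod_of_injective (fun a : γ.R i => (⟨a, γ.R_subset i a.2⟩ : G.V))
      (fun a b h => Subtype.ext (congrArg (fun z : G.V => (z : ι)) h)) _ _ (fun a ha => ?_)
      fun a => ?_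
    · split_ifs with h
      · rw [stat, if_neg]
        intro haS
        refine ha ⟨⟨a, F.mem_R a haS ?_⟩, rfl⟩
        by_contra hne
        obtain ⟨b, hb⟩ := Option.ne_none_iff_exists'.1 hne
        exact h ⟨b, hS (F.mem_of_par _ _ hb).1⟩ (Finset.mem_univ _) hb
      · rfl
    · rw [if_pos]
      · rfl
      · intro b _ h
        rw [F.par_eq_none a a.2] at h
        exact absurd h (by simp)
  set K : ℝ := ∏ v : G.V, (Fintype.card (X v) : ℝ)
  have hK : K ≠ 0 := Finset.prod_ne_zero_iff.2 fun v _ => by exact_mod_cast Fintype.card_ne_zero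
  set N : ℝ := ((Fintype.card (∀ v : G.V, γ.Fn X v) : ℕ) : ℝ)
  have hN : N ≠ 0 := by
    have : ∀ v : G.V, Nonempty (γ.Fn X v) := fun v =>
      ⟨(γ.uncurryEquiv X v).symm fun _ => (hX' v).some⟩
    exact Nat.cast_ne_zero.2 Fintype.card_ne_zero
  have hmem : (N / K) • q ∈ γ.T X i := by
    refine ⟨ε, hε, tendsto_const_nhds.congr' ?_⟩
    filter_upwards [self_mem_nhdsWithin] with η hη
    rw [γ.diffQuot_eq X i ε (ne_of_gt hη)]
    funext x
    have h := F.sum_prod_roots c hc x hX' Finset.univ fun _ _ _ _ => Finset.mem_univ _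
    rw [Pi.smul_apply, smul_eq_mul, div_mul_eq_mul_div, div_eq_iff hK, mul_comm _ K, ← h,
      Finset.sum_filter]
    congr 1
    refine Finset.sum_congr rfl fun f _ => ?_
    rw [hprod, Finset.prod_ite_zero]
    simp [evaluates_iff]
  have := (γ.T X i).smul_mem (N / K)⁻¹ hmem
  rwa [inv_smul_smul₀ (div_ne_zero hN hK)] at this

end Forest

/-! ### Products of functions of single coordinates -/

variable [∀ v, Fintype (X v)]

/-- For a connected set `S`, the products over `S ∪ pa(S)` of functions of single coordinates that
sum to zero on `sterile(S)` lie in the span of the derivatives. -/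
theorem prod_mem_iSup_T (hG : ∀ v ∈ G.V, ∃ e ∈ G.B, v ∈ e) (hX : ∀ v ∈ G.V, Nontrivial (X v))
    {S : Finset ι} (hne : S.Nonempty) (hS : G.IsBiConnected S) (h : ∀ a, X a → ℝ)
    (hsum : ∀ a ∈ G.sterile S, ∑ y, h a y = 0) :
    (fun x : State X G.verts => ∏ a : G.verts, if (a : ι) ∈ S ∪ G.paSet S then h a (x a) else 1) ∈
      ⨆ i, γ.T X i := by
  have hch : ∀ a, ∃ v, a ∈ G.paSet S → v ∈ S ∧ a ∈ G.pa v := by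
    intro a
    by_cases ha : a ∈ G.paSet S
    · obtain ⟨v, hv, hav⟩ := Finset.mem_biUnion.1 ha
      exact ⟨v, fun _ => ⟨hv, hav⟩⟩
    · exact ⟨a, fun h => absurd h ha⟩
  choose ch hch using hch
  -- A vertex of `S` with a child in `S` gets a factor without zeros that sums to zero; the factor
  -- of its child compensates for it.
  have hu : ∀ a, ∃ u : X a → ℝ, (a ∈ S → ∑ y, u y = 0) ∧
      (a ∈ S → a ∈ G.paSet S → ∀ y, u y ≠ 0) ∧ (a ∈ S → a ∉ G.paSet S → u = h a) := by
    intro a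
    by_cases ha : a ∈ S ∧ a ∈ G.paSet S
    · have := hX a (hS.1 ha.1)
      obtain ⟨u, hu, hu0⟩ := Fintype.exists_sum_eq_zero_forall_ne_zero (X a)
      exact ⟨u, fun _ => hu, fun _ _ => hu0, fun _ h => absurd ha.2 h⟩
    · exact ⟨h a, fun haS => hsum a (Finset.mem_sdiff.2 ⟨haS, fun h => ha ⟨haS, h⟩⟩),
        fun h1 h2 => absurd ⟨h1, h2⟩ ha, fun _ _ => rfl⟩
  choose u hu hu0 huh using hu
  let t : ∀ a, X a → ℝ := fun a y => if a ∈ S then h a y / u a y else h a y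
  let c : ∀ v, State X (G.pa v) → X v → ℝ := fun v y z =>
    u v z * ∏ a : G.pa v, if ch a = v then t a (y a) else 1
  have hc : ∀ v ∈ S, ∀ y, ∑ z, c v y z = 0 := fun v hv y => by
    simp only [c]
    rw [← Finset.sum_mul, hu v hv, zero_mul]
  obtain ⟨i, hroot, ⟨F⟩⟩ := γ.exists_forest hG hne hS
  have hmem := Submodule.mem_iSup_of_mem (p := fun i => γ.T X i) i
    (F.prod_mem_T c hS.1 hroot (fun v hv => (hX v hv).to_nonempty) hc)
  convert hmem using 1
  funext x
  have hSv : S ∪ G.paSet S ⊆ G.verts :=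
    Finset.union_subset (hS.1.trans Finset.subset_union_left) (paSet_subset_verts S)
  -- The factors as families of real numbers indexed by all of `ι`.
  let ev : (∀ a, X a → ℝ) → ι → ℝ := fun q a =>
    if ha : a ∈ G.verts then q a (x ⟨a, ha⟩) else 1
  have hev : ∀ (q : ∀ a, X a → ℝ) (a : ι) (ha : a ∈ G.verts), q a (x ⟨a, ha⟩) = ev q a :=
    fun q a ha => by simp only [ev, dif_pos ha]
  have hl : (∏ a : G.verts, if (a : ι) ∈ S ∪ G.paSet S then h a (x a) else 1) =
      ∏ a ∈ S ∪ G.paSet S, ev h a := by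
    rw [Fintype.prod_congr _ (fun a : G.verts => if (a : ι) ∈ S ∪ G.paSet S then ev h a else 1)
      fun a => by rw [← hev h a a.2], Finset.prod_coe_sort G.verts
      (fun a => if a ∈ S ∪ G.paSet S then ev h a else 1), Finset.prod_ite_mem,
      Finset.inter_eq_right.2 hSv]
  have hc' : ∀ v (hv : v ∈ G.V), c v (Finset.restrict₂ (G.pa_subset v) x)
      (x ⟨v, Finset.mem_union_left _ hv⟩) =
      ev u v * ∏ a ∈ G.pa v, if ch a = v then ev t a else 1 := by
    intro v hv
    rw [← Finset.prod_coe_sort (G.pa v)]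
    refine congrArg₂ (· * ·) (hev u v (Finset.mem_union_left _ hv)) ?_
    refine Fintype.prod_congr _ _ fun a => ?_
    rw [← hev t a (G.pa_subset v a.2)]
    rfl
  have hr : (∏ v : G.V, if (v : ι) ∈ S then c v (Finset.restrict₂ (G.pa_subset v) x)
      (x ⟨v, Finset.mem_union_left _ v.2⟩) else 1) =
      ∏ v ∈ S, (ev u v * ∏ a ∈ G.pa v, if ch a = v then ev t a else 1) := by
    rw [Fintype.prod_congr _ (fun v : G.V => if (v : ι) ∈ S then
      ev u v * ∏ a ∈ G.pa v, (if ch a = v then ev t a else 1) else 1) fun v => by rw [hc' v v.2],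
      Finset.prod_coe_sort G.V (fun v => if v ∈ S then
      ev u v * ∏ a ∈ G.pa v, (if ch a = v then ev t a else 1) else 1), Finset.prod_ite_mem,
      Finset.inter_eq_right.2 hS.1]
  have hfib : ∏ v ∈ S, ∏ a ∈ G.pa v, (if ch a = v then ev t a else 1) =
      ∏ a ∈ G.paSet S, ev t a := by
    rw [← Finset.prod_fiberwise_of_maps_to (fun a ha => (hch a ha).1)]
    refine Finset.prod_congr rfl fun v hv => ?_
    rw [← Finset.prod_filter]
    congr 1
    ext a
    simp only [Finset.mem_filter]
    constructor
    · rintro ⟨ha, rfl⟩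
      exact ⟨Finset.mem_biUnion.2 ⟨_, hv, ha⟩, rfl⟩
    · rintro ⟨ha, rfl⟩
      exact ⟨(hch a ha).2, rfl⟩
  have hinter : ∀ {B : Finset ι} (_ : B ⊆ S ∪ G.paSet S) (q : ι → ℝ),
      ∏ a ∈ B, q a = ∏ a ∈ S ∪ G.paSet S, if a ∈ B then q a else 1 := fun hB q => by
    rw [Finset.prod_ite_mem, Finset.inter_eq_right.2 hB]
  rw [hl, hr, Finset.prod_mul_distrib, hfib, hinter Finset.subset_union_left (ev u),
    hinter Finset.subset_union_right (ev t), ← Finset.prod_mul_distrib]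
  refine Finset.prod_congr rfl fun a ha => ?_
  have hav := hSv ha
  simp only [ev, dif_pos hav]
  by_cases h1 : a ∈ S <;> by_cases h2 : a ∈ G.paSet S
  · have := hu0 a h1 h2 (x ⟨a, hav⟩)
    simp only [t, h1, h2, if_true]
    field_simp
  · simp [h1, h2, huh a h1 h2]
  · simp [t, h1, h2]
  · simp [h1, h2] at ha

/-- For a connected set `S`, the space `Λ_A` lies in the span of the derivatives whenever
`sterile(S) ⊆ A ⊆ S ∪ pa(S)`. -/
theorem Lam_le_iSup_T (hG : ∀ v ∈ G.V, ∃ e ∈ G.B, v ∈ e) (hX : ∀ v ∈ G.V, Nontrivial (X v))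
    {S A : Finset ι} (hne : S.Nonempty) (hS : G.IsBiConnected S) (hSA : G.sterile S ⊆ A)
    (hA : A ⊆ S ∪ G.paSet S) : Lam X G.verts A ≤ ⨆ i, γ.T X i := by
  intro p hp
  have hprod : ∀ z : State X G.verts, (fun x : State X G.verts =>
      ∏ a : G.verts, lamKernel X A a (z a) (x a)) ∈ ⨆ i, γ.T X i := by
    intro z
    let h : ∀ a, X a → ℝ := fun a y =>
      if ha : a ∈ G.verts then lamKernel X A a (z ⟨a, ha⟩) y else 0
    have hmem := Submodule.smul_mem _
      (∏ a : G.verts, if (a : ι) ∈ S ∪ G.paSet S then 1 else (Fintype.card (X a) : ℝ)⁻¹)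
      (γ.prod_mem_iSup_T X hG hX hne hS h fun a ha => by
        by_cases hav : a ∈ G.verts
        · simpa [h, hav] using sum_lamKernel (hSA ha) _
        · simp [h, hav])
    convert hmem using 1
    funext x
    rw [Pi.smul_apply, smul_eq_mul, ← Finset.prod_mul_distrib]
    refine Finset.prod_congr rfl fun a _ => ?_
    by_cases ha : (a : ι) ∈ S ∪ G.paSet S
    · simp only [if_pos ha, one_mul, h, dif_pos a.2]
    · simp only [if_neg ha, mul_one, lamKernel, if_neg fun h' => ha (hA h')]
  have hp' : p = ∑ z : State X G.verts, p z • fun x : State X G.verts =>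
      ∏ a : G.verts, lamKernel X A a (z a) (x a) := by
    funext x
    rw [Lam.eq_sum_prod_lamKernel hp x]
    simp
  rw [hp']
  exact Submodule.sum_mem _ fun z _ => Submodule.smul_mem _ _ (hprod z)

end Gearing

end MDAG

theorem corollary5p6 {ι : Type u} [DecidableEq ι] (G : MDAG ι)
    (hG : ∀ v ∈ G.V, ∃ e ∈ G.B, v ∈ e)
    (X : ι → Type w) [∀ v, Fintype (X v)] (hX : ∀ v ∈ G.V, Nontrivial (X v))
    {k : ℕ} (γ : G.Gearing k) :
    iSupIndep (fun A : G.parametrizableSets => MDAG.Lam X G.verts (A : Finset ι)) ∧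
      (⨆ A : G.parametrizableSets, MDAG.Lam X G.verts (A : Finset ι)) ≤
        ⨆ i : Fin k, γ.T X i := by
  refine ⟨MDAG.iSupIndep_Lam _ ?_, iSup_le ?_⟩
  · rintro _ ⟨S, hS, A', hA', rfl⟩
    have h := hS.nonempty_and_isBiConnected.2.1
    exact Finset.union_subset (Finset.sdiff_subset.trans (h.trans Finset.subset_union_left))
      (hA'.trans (MDAG.paSet_subset_verts S))
  · rintro ⟨_, S, hS, A', hA', rfl⟩
    obtain ⟨hne, hconn⟩ := hS.nonempty_and_isBiConnected
    exact γ.Lam_le_iSup_T X hG hX hne hconn Finset.subset_union_left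
      (Finset.union_subset_union Finset.sdiff_subset hA')
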